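/- Let $\Sigma$ and $\Gamma$ be finite alphabets. A transducer over $\Gamma$ is a finite automaton over the monoid $\Gamma^*\times\Gamma^*$ with a single initial state and with labels in $(\Gamma\cup\{\varepsilon\})\times(\Gamma\cup\{\varepsilon\})$; it is identified with the set of pairs of words that it accepts. It is \emph{synchronized} if every path $q_0\xrightarrow{x_1/y_1}q_1\cdots\xrightarrow{x_n/y_n}q_n$ from its initial state $q_0$ admits some $k\in[0,n]$ such that $x_j,y_j\in\Gamma$ for all $j\le k$, and either $x_j=\varepsilon$ for all $j>k$ or $y_j=\varepsilon$ for all $j>k$. A \emph{synchronized graph} is a directed graph $G$ with vertices in $\Gamma^*$ and edge labels in $\Sigma$ given by a family $(T_a)_{a\in\Sigma}$ of synchronized transducers over $\Gamma$: there is an edge $u\xrightarrow{a}v$ if and only if $(u,v)\in T_a$. The graph $G$ is \emph{deterministic} if no two distinct edges have the same source and the same label. For a vertex $i\in\Gamma^*$ and a set $F\subseteq\Gamma^*$, $L(G,\{i\},F)\subseteq\Sigma^*$ is the set of labels of the paths of $G$ from $i$ to an element of $F$. A language is \emph{deterministic context-sensitive} if it is accepted by a deterministic linearly bounded machine (LBM),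 that is, a deterministic Turing machine which works in linear space; it accepts a word by reaching an accepting state. \textbf{Proposition.} Let $G$ be a deterministic synchronized graph, $i\in\Gamma^*$ a vertex and $F\subseteq\Gamma^*$ a rational (regular) set of vertices. Then the language $L(G,\{i\},F)$ is deterministic context-sensitive. This holds both when the empty path from $i$ to $i$ is counted as a path (so that $\varepsilon\in L(G,\{i\},F)$ if and only if $i\in F$) and when only paths with at least one edge are counted (so that $L(G,\{i\},F)\subseteq\Sigma^+$). -/

import Mathlib

namespace RatGraph

/-- A directed graph with vertex set `V` and edge labels in `A`, given by its set of edges;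
it is simple since the edges form a relation. -/
structure LGraph (V A : Type) where
  /-- `Edge s a t`: there is an edge of source `s`, label `a` and target `t`. -/
  Edge : V → A → V → Prop

namespace LGraph

variable {V A : Type}

/-- `G.Path s w t`: there is a path from `s` to `t` labelled by the word `w`
(the empty path from `s` to `s` is labelled by the empty word). -/
inductive Path (G : LGraph V A) : V → List A → V → Prop
  | nil (s : V) : Path G s [] s
  | cons {s r t : V} {a : A} {w : List A} :
      G.Edge s a r → Path G r w t → Path G s (a :: w) t

/-- No two distinct edges have the same source and the same label. -/
def IsDeterministic (G : LGraph V A) : Prop :=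
  ∀ (s : V) (a : A) (t t' : V), G.Edge s a t → G.Edge s a t' → t = t'

/-- The language of the labels of the paths from `I` to `F`. -/
def pathLanguage (G : LGraph V A) (I F : Set V) : Language A :=
  {w : List A | ∃ s ∈ I, ∃ t ∈ F, G.Path s w t}

/-- The language of the labels of the paths from `I` to `F` that have at least one edge. -/
def nonemptyPathLanguage (G : LGraph V A) (I F : Set V) : Language A :=
  {w : List A | w ≠ [] ∧ ∃ s ∈ I, ∃ t ∈ F, G.Path s w t}

end LGraph

/-- A transducer over the alphabet `Γ` with control states `Q`: an automaton over the monoid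
`Γ* × Γ*` with labels in `(Γ ∪ {ε}) × (Γ ∪ {ε})`, where `none` stands for `ε`. -/
structure Transducer (Γ Q : Type) where
  start : Q
  final : Set Q
  trans : Q → Option Γ × Option Γ → Q → Prop

namespace Transducer

variable {Γ Q : Type}

/-- `T.Run q l q'`: there is a run of `T` from `q` to `q'` whose sequence of labels is `l`. -/
inductive Run (T : Transducer Γ Q) : Q → List (Option Γ × Option Γ) → Q → Prop
  | nil (q : Q) : Run T q [] q
  | cons {q r q' : Q} {x : Option Γ × Option Γ} {l : List (Option Γ × Option Γ)} :
      T.trans q x r → Run T r l q' → Run T q (x :: l) q'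

/-- The relation accepted by a transducer: `(u, v)` is the product, in `Γ* × Γ*`, of the labels
of an accepting run. -/
def Rel (T : Transducer Γ Q) (u v : List Γ) : Prop :=
  ∃ l : List (Option Γ × Option Γ), ∃ q ∈ T.final, T.Run T.start l q ∧
    (l.map Prod.fst).reduceOption = u ∧ (l.map Prod.snd).reduceOption = v

/-- A transducer is (left-)synchronized if the label sequence of every path from the initial
state consists of a (possibly empty) part with labels in `Γ × Γ`, followed by a (possibly empty)
part in which all inputs are `ε` or all outputs are `ε`. -/
def IsSynchronized (T : Transducer Γ Q) : Prop :=
  ∀ (l : List (Option Γ × Option Γ)) (q : Q), T.Run T.start l q →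
    ∃ l₁ l₂ : List (Option Γ × Option Γ), l = l₁ ++ l₂ ∧
      (∀ x ∈ l₁, x.1 ≠ none ∧ x.2 ≠ none) ∧
      ((∀ x ∈ l₂, x.1 = none) ∨ (∀ x ∈ l₂, x.2 = none))

end Transducer

/-- The rational graph given by a family of transducers indexed by the edge labels: its vertices
are the words over `Γ`, and it has an edge `u -a-> v` if and only if `(u, v) ∈ T a`. -/
def rationalGraph {A Γ : Type} {Q : A → Type} (T : ∀ a, Transducer Γ (Q a)) :
    LGraph (List Γ) A where
  Edge u a v := (T a).Rel u v

/-- A deterministic Turing machine with input alphabet `A`, control states `Q`, tape alphabet `S`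
(which contains a copy of `A` and a blank symbol outside this copy), and one two-way infinite
tape. It halts where `trans` is `none`. -/
structure DTM (A Q S : Type) where
  start : Q
  accept : Set Q
  blank : S
  input : A → S
  input_injective : Function.Injective input
  input_ne_blank : ∀ a, input a ≠ blank
  /-- From the current state and the scanned symbol: the next state, the symbol to write and the
  direction in which the head moves. -/
  trans : Q → S → Option (Q × S × Turing.Dir)

namespace DTM

variable {A Q S : Type}

/-- A configuration: control state, position of the head, content of the tape. -/
structure Cfg (Q S : Type) where
  state : Q
  head : ℤ
  tape : ℤ → S

/-- The neighbouring cell in a given direction. -/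
def move : Turing.Dir → ℤ → ℤ
  | Turing.Dir.left, p => p - 1
  | Turing.Dir.right, p => p + 1

/-- One computation step, or `none` if the machine halts. -/
def step (M : DTM A Q S) (c : Cfg Q S) : Option (Cfg Q S) :=
  (M.trans c.state (c.tape c.head)).map fun m =>
    { state := m.1
      head := move m.2.2 c.head
      tape := Function.update c.tape c.head m.2.1 }

/-- The tape on which `w` is written on the cells `0, …, |w| - 1`, all other cells being blank. -/
def inputTape (M : DTM A Q S) (w : List A) : ℤ → S
  | Int.ofNat k => (w[k]?).elim M.blank M.input
  | Int.negSucc _ => M.blank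

/-- The initial configuration on input `w`. -/
def init (M : DTM A Q S) (w : List A) : Cfg Q S where
  state := M.start
  head := 0
  tape := M.inputTape w

/-- `M.Reaches w c`: the configuration `c` occurs in the computation of `M` on input `w`. -/
def Reaches (M : DTM A Q S) (w : List A) (c : Cfg Q S) : Prop :=
  Relation.ReflTransGen (fun c₁ c₂ => M.step c₁ = some c₂) (M.init w) c

/-- The language accepted by `M`: the inputs on which `M` reaches an accepting state. -/
def acceptedLanguage (M : DTM A Q S) : Language A :=
  {w : List A | ∃ c, M.Reaches w c ∧ c.state ∈ M.accept}

/-- `M` works in linear space: on every input `w` its head remains at distance `O(|w| + 1)` of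
its initial position (the `+ 1` only matters for the empty input). -/
def IsLinearlyBounded (M : DTM A Q S) : Prop :=
  ∃ k : ℕ, ∀ (w : List A) (c : Cfg Q S), M.Reaches w c → |c.head| ≤ (k : ℤ) * ((w.length : ℤ) + 1)

end DTM

/-- A language is deterministic context-sensitive if it is accepted by a deterministic linearly
bounded machine, i.e. a deterministic Turing machine (with finitely many states and tape symbols)
that works in linear space. -/
def IsDetContextSensitive {A : Type} (L : Language A) : Prop :=
  ∃ (Q S : Type) (_ : Finite Q) (_ : Finite S) (M : DTM A Q S),
    M.IsLinearlyBounded ∧ M.acceptedLanguage = L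

end RatGraph

/-! Linear space suffices because a synchronized transducer lengthens a word only in a final phase
that no longer reads. Before that phase, each letter written goes with a letter read. A final phase
with empty input joins two states, and there are finitely many pairs of states, so it can be
replaced by one of length at most a constant `c` (`exists_bound_of_input_nil`,
`IsSynchronized.exists_run`). The replacement may change the output, but the new output is still the
target of an edge with the same source and label, and determinism of the graph makes it the same
vertex. Hence each edge adds at most `c` letters to the vertex.

This growth is paid for by the input. The tape has one cell per input letter and one more, and a
cell holds a possibly unused letter and a word of length at most `K = |i| + c`. The current vertex
is the concatenation of these words. Following an edge uses up the first unused letter `a`. Earlier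
cells are rewritten in place, and the cell of `a` takes the at most `c` extra letters; the later
cells are still empty. This is one pass of a letter-to-letter transducer on cells
(`blockTransducer`), which checks membership in `F` once no letter remains.

Such a pass is nondeterministic. A deterministic machine performs it in two sweeps: from right to
left it writes on each cell the set of states from which the rest can be completed, and from left to
right it follows a run that stays in these sets (`steps_back`, `steps_fwd`, `round`). Any run will
do, again by determinism of the graph. `acceptsFrom_roundStart_iff` assembles this by induction on
the unused input. -/

namespace RatGraph

/-! ### Turing machines on tapes given by lists -/

namespace DTM

variable {A Q S : Type}

/-- The tape on which `l` is written from cell `0` on, all other cells containing `b`. -/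
def listTape (b : S) (l : List S) : ℤ → S
  | Int.ofNat k => l.getD k b
  | Int.negSucc _ => b

theorem listTape_natCast (b : S) (l : List S) (k : ℕ) : listTape b l (k : ℤ) = l.getD k b := rfl

theorem listTape_length (b : S) (l : List S) : listTape b l (l.length : ℤ) = b := by
  simp [listTape_natCast]

theorem listTape_neg_one (b : S) (l : List S) : listTape b l (-1) = b := rfl

theorem listTape_append_cons (b : S) (l r : List S) (x : S) :
    listTape b (l ++ x :: r) (l.length : ℤ) = x := by
  simp [listTape_natCast]

theorem update_listTape_append_cons (b : S) (l r : List S) (x y : S) :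
    Function.update (listTape b (l ++ x :: r)) (l.length : ℤ) y = listTape b (l ++ y :: r) := by
  funext z
  rcases z with k | k
  · by_cases h : k = l.length
    · subst h
      rw [Int.ofNat_eq_natCast, Function.update_self, listTape_append_cons]
    · rw [Function.update_of_ne (by simpa using h)]
      simp only [listTape, List.getD_eq_getElem?_getD, List.getElem?_append]
      split_ifs with hk
      · rfl
      · obtain ⟨m, hm⟩ : ∃ m, k - l.length = m + 1 := ⟨k - l.length - 1, by omega⟩
        simp [hm]
  · rw [Function.update_of_ne (by simp)]
    · rfl

theorem update_listTape_length (b : S) (l : List S) (y : S) :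
    Function.update (listTape b l) (l.length : ℤ) y = listTape b (l ++ [y]) := by
  have h : listTape b l = listTape b (l ++ [b]) := by
    funext z
    rcases z with k | k
    · simp only [listTape, List.getD_eq_getElem?_getD, List.getElem?_append]
      split_ifs with hk
      · rfl
      · rw [List.getElem?_eq_none (by omega)]
        rcases Nat.eq_zero_or_pos (k - l.length) with h | h
        · simp [h]
        · rw [List.getElem?_eq_none (by simpa using by omega)]
    · rfl
  rw [h, update_listTape_append_cons]

/-- The configuration with tape `l ++ r` whose head scans the first cell of `r`. -/
def atRight (M : DTM A Q S) (q : Q) (l r : List S) : Cfg Q S :=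
  ⟨q, l.length, listTape M.blank (l ++ r)⟩

/-- The configuration with tape `l ++ r` whose head scans the last cell of `l`. -/
def atLeft (M : DTM A Q S) (q : Q) (l r : List S) : Cfg Q S :=
  ⟨q, l.length - 1, listTape M.blank (l ++ r)⟩

variable (M : DTM A Q S) {q q' : Q} {x y : S}

theorem init_eq (w : List A) : M.init w = M.atRight M.start [] (w.map M.input) := by
  have : M.inputTape w = listTape M.blank (w.map M.input) := by
    funext z
    rcases z with k | k
    · simp only [inputTape, listTape, List.getD_eq_getElem?_getD, List.getElem?_map]
      cases w[k]? <;> rfl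
    · rfl
  simp [init, atRight, this]

theorem step_atRight_cons (h : M.trans q x = some (q', y, Turing.Dir.right)) (l r : List S) :
    M.step (M.atRight q l (x :: r)) = some (M.atRight q' (l ++ [y]) r) := by
  simp [step, atRight, listTape_append_cons, h, update_listTape_append_cons, move]

theorem step_atLeft_append (h : M.trans q x = some (q', y, Turing.Dir.left)) (l r : List S) :
    M.step (M.atLeft q (l ++ [x]) r) = some (M.atLeft q' l (y :: r)) := by
  simp [step, atLeft, listTape_append_cons, h, update_listTape_append_cons, move]

theorem step_atRight_nil (h : M.trans q M.blank = some (q', M.blank, Turing.Dir.left))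
    (l : List S) : M.step (M.atRight q l []) = some (M.atLeft q' l []) := by
  have hu : Function.update (listTape M.blank l) (l.length : ℤ) M.blank = listTape M.blank l := by
    rw [Function.update_eq_self_iff, listTape_length]
  simp [step, atLeft, atRight, listTape_length, h, hu, move]

theorem step_atRight_extend (h : M.trans q M.blank = some (q', y, Turing.Dir.right))
    (l : List S) : M.step (M.atRight q l []) = some (M.atRight q' (l ++ [y]) []) := by
  simp [step, atRight, listTape_length, h, update_listTape_length, move]

theorem step_atLeft_nil (h : M.trans q M.blank = some (q', M.blank, Turing.Dir.right))
    (r : List S) : M.step (M.atLeft q [] r) = some (M.atRight q' [] r) := by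
  have hu : Function.update (listTape M.blank r) (-1) M.blank = listTape M.blank r := by
    rw [Function.update_eq_self_iff, listTape_neg_one]
  simp [step, atLeft, atRight, listTape_neg_one, h, hu, move]

theorem step_eq_none {c : Cfg Q S} (h : M.trans c.state (c.tape c.head) = none) :
    M.step c = none := by
  simp [step, h]

/-- A number of computation steps. -/
def Steps : Cfg Q S → Cfg Q S → Prop :=
  Relation.ReflTransGen (fun c₁ c₂ => M.step c₁ = some c₂)

/-- An accepting state is reached from the configuration `c`. -/
def AcceptsFrom (c : Cfg Q S) : Prop :=
  ∃ d, M.Steps c d ∧ d.state ∈ M.accept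

variable {M}

theorem Steps.single {c d : Cfg Q S} (h : M.step c = some d) : M.Steps c d :=
  Relation.ReflTransGen.single h

theorem Steps.trans {c d e : Cfg Q S} (h : M.Steps c d) (h' : M.Steps d e) : M.Steps c e :=
  Relation.ReflTransGen.trans h h'

theorem Steps.eq_of_step_eq_none {c d : Cfg Q S} (h : M.Steps c d) (hc : M.step c = none) :
    d = c := by
  rcases Relation.ReflTransGen.cases_head h with h | ⟨e, he, -⟩
  · exact h.symm
  · simp [hc] at he

/-- Steps are deterministic, so two computations from `c` are comparable; an accepting configuration
has halted and cannot strictly precede `d`. -/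
theorem Steps.acceptsFrom_iff (hM : ∀ c : Cfg Q S, c.state ∈ M.accept → M.step c = none)
    {c d : Cfg Q S} (h : M.Steps c d) : M.AcceptsFrom c ↔ M.AcceptsFrom d := by
  constructor
  · rintro ⟨e, he, hacc⟩
    have hu : Relator.RightUnique (fun c₁ c₂ => M.step c₁ = some c₂) := by
      intro a b b' hb hb'
      rw [hb] at hb'
      exact Option.some.inj hb'
    rcases Relation.ReflTransGen.total_of_right_unique hu h he with h' | h'
    · exact ⟨e, h', hacc⟩
    · have := Steps.eq_of_step_eq_none h' (hM e hacc)
      subst this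
      exact ⟨d, Relation.ReflTransGen.refl, hacc⟩
  · rintro ⟨e, he, hacc⟩
    exact ⟨e, h.trans he, hacc⟩

theorem not_acceptsFrom_of_step_eq_none {c : Cfg Q S} (hc : M.step c = none)
    (hacc : c.state ∉ M.accept) : ¬ M.AcceptsFrom c := by
  rintro ⟨d, hd, hd'⟩
  rw [hd.eq_of_step_eq_none hc] at hd'
  exact hacc hd'

end DTM

/-! ### Iterating a letter-to-letter transducer on the tape -/

/-- A nondeterministic letter-to-letter transducer over the alphabet `B`; those of its final
states that belong to `accept` end the iteration of the transducer. -/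
structure LetterTransducer (B P : Type) where
  step : P → B → B → P → Prop
  start : Set P
  final : Set P
  accept : Set P

namespace LetterTransducer

variable {A B P : Type} (N : LetterTransducer B P)

/-- `N.Run p X Y q`: there is a run from `p` to `q` of input `X` and output `Y`. -/
inductive Run : P → List B → List B → P → Prop
  | nil (p : P) : Run p [] [] p
  | cons {p r q : P} {x y : B} {X Y : List B} :
      N.step p x y r → Run r X Y q → Run p (x :: X) (y :: Y) q

/-- The states from which some run of input `X` ends in a final state. -/
def good : List B → Set P
  | [] => N.final
  | x :: X => {p | ∃ z : B × P, N.step p x z.1 z.2 ∧ z.2 ∈ good X}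

variable {N} in
theorem Run.mem_good {p q : P} {X Y : List B} (h : N.Run p X Y q) (hq : q ∈ N.final) :
    p ∈ N.good X := by
  induction h with
  | nil p => exact hq
  | cons h _ ih => exact ⟨(_, _), h, ih hq⟩

/-- The states of a machine that iterates a letter-to-letter transducer. -/
inductive SweepState (P : Type) : Type
  | init (first : Bool)
  | turn
  | back (G : Set P)
  | fwd (p : P)
  | acc

/-- The tape symbols of a machine that iterates a letter-to-letter transducer. -/
inductive SweepSymbol (A B P : Type) : Type
  | blank
  | input (a : A)
  | cell (x : B)
  | ann (x : B) (G : Set P)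

instance [Finite P] : Finite (SweepState P) :=
  Finite.of_injective
    (fun s : SweepState P => match s with
      | .init b => (Sum.inl b : Bool ⊕ Set P ⊕ Option (Option P))
      | .turn => Sum.inr (Sum.inr none)
      | .back G => Sum.inr (Sum.inl G)
      | .fwd p => Sum.inr (Sum.inr (some (some p)))
      | .acc => Sum.inr (Sum.inr (some none)))
    (by rintro (_ | _ | _ | _ | _) (_ | _ | _ | _ | _) <;> simp)

instance [Finite A] [Finite B] [Finite P] : Finite (SweepSymbol A B P) :=
  Finite.of_injective
    (fun s : SweepSymbol A B P => match s with
      | .blank => (none : Option (A ⊕ B ⊕ B × Set P))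
      | .input a => some (Sum.inl a)
      | .cell x => some (Sum.inr (Sum.inl x))
      | .ann x G => some (Sum.inr (Sum.inr (x, G))))
    (by rintro (_ | _ | _ | _) (_ | _ | _ | _) <;> simp)

open Classical in
/-- The transition function of `sweepMachine`. -/
noncomputable def sweepTrans (enc : Bool → Option A → B) (ε : Prop) :
    SweepState P → SweepSymbol A B P → Option (SweepState P × SweepSymbol A B P × Turing.Dir)
  | .init b, .input a => some (.init false, .cell (enc b (some a)), .right)
  -- Here `b = true` means that no input symbol was met, that is, the input is empty.
  | .init b, .blank =>
      if b = true → ε then some (.turn, .cell (enc b none), .right) else none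
  | .turn, .blank => some (.back N.final, .blank, .left)
  | .back G, .cell x =>
      some (.back {p | ∃ z : B × P, N.step p x z.1 z.2 ∧ z.2 ∈ G}, .ann x G, .left)
  | .back G, .blank =>
      if h : ∃ p ∈ N.start, p ∈ G then some (.fwd h.choose, .blank, .right) else none
  | .fwd p, .ann x G =>
      if h : ∃ z : B × P, N.step p x z.1 z.2 ∧ z.2 ∈ G then
        some (.fwd h.choose.2, .cell h.choose.1, .right) else none
  | .fwd p, .blank =>
      if p ∈ N.accept then some (.acc, .blank, .left) else some (.back N.final, .blank, .left)
  | _, _ => none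

/-- The machine that iterates the transducer `N`. It first replaces the input by letters of `B`,
using one cell more than the input. It then alternates sweeps from right to left, which write on
each cell the states that are good for what is to its right, with sweeps from left to right,
which follow a run of `N`. The empty word is rejected at once unless `ε` holds. -/
noncomputable def sweepMachine (enc : Bool → Option A → B) (ε : Prop) :
    DTM A (SweepState P) (SweepSymbol A B P) where
  start := .init true
  accept := {.acc}
  blank := .blank
  input := .input
  input_injective := fun a b h => by cases h; rfl
  input_ne_blank := fun a h => by cases h
  trans := N.sweepTrans enc ε

/-- What the head and the tape satisfy during the computation of `sweepMachine` on inputs of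
length `n`. -/
def HeadInv (n : ℕ) (c : DTM.Cfg (SweepState P) (SweepSymbol A B P)) : Prop :=
  c.tape (-1) = .blank ∧ c.tape (n + 1) = .blank ∧
    match c.state with
    | .init _ => 0 ≤ c.head ∧ c.head ≤ n ∧ c.tape n = .blank
    | .turn => 0 ≤ c.head ∧ c.head ≤ n + 1
    | .back _ => -1 ≤ c.head ∧ c.head ≤ n
    | .fwd _ => 0 ≤ c.head ∧ c.head ≤ n + 1
    | .acc => -1 ≤ c.head ∧ c.head ≤ n + 1

/-- Cells `-1` and `n + 1` are blank guards: no transition scans a guard and writes something else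
there, and the head turns back or halts on reaching one. -/
theorem HeadInv.step {enc : Bool → Option A → B} {ε : Prop} {n : ℕ}
    {c d : DTM.Cfg (SweepState P) (SweepSymbol A B P)} (h : HeadInv n c)
    (hd : (N.sweepMachine enc ε).step c = some d) : HeadInv n d := by
  obtain ⟨q, p, t⟩ := c
  obtain ⟨h₁, h₂, h₃⟩ := h
  simp only at h₁ h₂ h₃
  -- A head on a nonblank symbol is on neither guard, so one more move keeps it in range.
  have hb : t p ≠ .blank → p ≠ -1 ∧ p ≠ n + 1 :=
    fun hp => ⟨fun e => hp (e ▸ h₁), fun e => hp (e ▸ h₂)⟩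
  have hself : t p = .blank → Function.update t p .blank = t :=
    fun hp => by rw [Function.update_eq_self_iff, hp]
  simp only [DTM.step, sweepMachine, Option.map_eq_some_iff] at hd
  obtain ⟨m, hm, rfl⟩ := hd
  rcases q with b | _ | G | p' | _ <;> rcases hs : t p with _ | a | x | ⟨x, G'⟩ <;>
    simp only [hs, sweepTrans, reduceCtorEq] at hm
  · split_ifs at hm
    obtain rfl := Option.some.inj hm
    simp only at h₃
    refine ⟨?_, ?_, ?_⟩
    · simpa [Function.update_of_ne (show (-1 : ℤ) ≠ p by omega)] using h₁
    · simpa [Function.update_of_ne (show (n + 1 : ℤ) ≠ p by omega)] using h₂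
    · simp only [DTM.move]; omega
  · obtain rfl := Option.some.inj hm
    simp only at h₃
    -- Cell `n` is blank until the extra cell is written, so a head on an input symbol is strictly
    -- left of it.
    have hp : p ≠ n := fun e => by rw [e, h₃.2.2] at hs; cases hs
    refine ⟨?_, ?_, ?_⟩
    · simpa [Function.update_of_ne (show (-1 : ℤ) ≠ p by omega)] using h₁
    · simpa [Function.update_of_ne (show (n + 1 : ℤ) ≠ p by omega)] using h₂
    · simp only [DTM.move, Function.update_of_ne hp.symm]
      exact ⟨by omega, by omega, h₃.2.2⟩
  · obtain rfl := Option.some.inj hm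
    simp only at h₃
    exact ⟨by rwa [hself hs], by rwa [hself hs], by simp only [DTM.move]; omega⟩
  · split_ifs at hm
    obtain rfl := Option.some.inj hm
    simp only at h₃
    exact ⟨by rwa [hself hs], by rwa [hself hs], by simp only [DTM.move]; omega⟩
  · obtain rfl := Option.some.inj hm
    obtain ⟨hp, hp'⟩ := hb (by rw [hs]; exact fun e => by cases e)
    simp only at h₃
    refine ⟨?_, ?_, ?_⟩
    · simpa [Function.update_of_ne hp.symm] using h₁
    · simpa [Function.update_of_ne hp'.symm] using h₂
    · simp only [DTM.move]; omega
  · simp only at h₃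
    split_ifs at hm <;> obtain rfl := Option.some.inj hm <;>
      exact ⟨by rwa [hself hs], by rwa [hself hs], by simp only [DTM.move]; omega⟩
  · split_ifs at hm
    obtain rfl := Option.some.inj hm
    obtain ⟨hp, hp'⟩ := hb (by rw [hs]; exact fun e => by cases e)
    simp only at h₃
    refine ⟨?_, ?_, ?_⟩
    · simpa [Function.update_of_ne hp.symm] using h₁
    · simpa [Function.update_of_ne hp'.symm] using h₂
    · simp only [DTM.move]; omega

theorem isLinearlyBounded_sweepMachine (enc : Bool → Option A → B) (ε : Prop) :
    (N.sweepMachine enc ε).IsLinearlyBounded := by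
  refine ⟨1, fun w c hc => ?_⟩
  have hinv : HeadInv w.length c := by
    induction hc with
    | refl =>
      refine ⟨rfl, ?_, le_rfl, Int.natCast_nonneg _, ?_⟩
      · change (w[w.length + 1]?).elim _ _ = _
        rw [List.getElem?_eq_none (by omega)]
        rfl
      · change (w[w.length]?).elim _ _ = _
        rw [List.getElem?_eq_none le_rfl]
        rfl
    | tail _ h ih => exact HeadInv.step N ih h
  obtain ⟨q, p, t⟩ := c
  obtain ⟨-, -, h⟩ := hinv
  rw [abs_le]
  rcases q with _ | _ | _ | _ | _ <;> simp only at h ⊢ <;> constructor <;> push_cast <;> linarith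

/-! ### Correctness of the sweeping machine -/

variable (enc : Bool → Option A → B) (ε : Prop)

/-- The configuration in which the tape content is `X` and the next iteration begins. -/
noncomputable def roundStart (X : List B) : DTM.Cfg (SweepState P) (SweepSymbol A B P) :=
  (N.sweepMachine enc ε).atLeft (.back N.final) (X.map .cell) []

theorem step_eq_none_of_accept (c : DTM.Cfg (SweepState P) (SweepSymbol A B P))
    (hc : c.state ∈ (N.sweepMachine enc ε).accept) : (N.sweepMachine enc ε).step c = none := by
  apply DTM.step_eq_none
  obtain ⟨q, p, t⟩ := c
  obtain rfl : q = .acc := hc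
  change N.sweepTrans enc ε .acc (t p) = none
  cases t p <;> rfl

/-- The letters of `X`, each together with the states that are good for what follows. -/
def annotate : List B → List (SweepSymbol A B P)
  | [] => []
  | x :: X => .ann x (N.good X) :: annotate X

theorem steps_back (X Z : List B) :
    (N.sweepMachine enc ε).Steps
      ((N.sweepMachine enc ε).atLeft (.back (N.good Z)) (X.map .cell) (N.annotate Z))
      ((N.sweepMachine enc ε).atLeft (.back (N.good (X ++ Z))) [] (N.annotate (X ++ Z))) := by
  induction X using List.reverseRecOn generalizing Z with
  | nil => exact Relation.ReflTransGen.refl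
  | append_singleton X x ih =>
    rw [List.map_append, List.append_assoc]
    exact (DTM.Steps.single (DTM.step_atLeft_append _ rfl _ _)).trans (ih (x :: Z))

/-- The annotation of a cell guarantees that a good state has a good successor, so the greedy choice
never gets stuck and ends in a final state. -/
theorem steps_fwd (X Z : List B) {p : P} (hp : p ∈ N.good X) :
    ∃ Y q, N.Run p X Y q ∧ q ∈ N.final ∧
      (N.sweepMachine enc ε).Steps
        ((N.sweepMachine enc ε).atRight (.fwd p) (Z.map .cell) (N.annotate X))
        ((N.sweepMachine enc ε).atRight (.fwd q) ((Z ++ Y).map .cell) []) := by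
  induction X generalizing Z p with
  | nil => exact ⟨[], p, .nil p, hp, by rw [List.append_nil]; exact Relation.ReflTransGen.refl⟩
  | cons x X ih =>
    have h : ∃ z : B × P, N.step p x z.1 z.2 ∧ z.2 ∈ N.good X := hp
    -- The run must be the one the machine selects, hence the same `choose` as in `sweepTrans`.
    obtain ⟨Y, q, hY, hq, hs⟩ := ih (Z ++ [h.choose.1]) h.choose_spec.2
    refine ⟨h.choose.1 :: Y, q, .cons h.choose_spec.1 hY, hq, ?_⟩
    rw [List.append_assoc, List.map_append] at hs
    exact (DTM.Steps.single (DTM.step_atRight_cons _ (by exact dif_pos h) _ _)).trans hs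

/-- One iteration: either the transducer has no run on `X` and the machine rejects, or the
machine follows some run. -/
theorem round (X : List B) :
    ((¬ ∃ p ∈ N.start, ∃ Y, ∃ q ∈ N.final, N.Run p X Y q) ∧
      ¬ (N.sweepMachine enc ε).AcceptsFrom (N.roundStart enc ε X)) ∨
    ∃ p ∈ N.start, ∃ Y, ∃ q ∈ N.final, N.Run p X Y q ∧
      (q ∈ N.accept → (N.sweepMachine enc ε).AcceptsFrom (N.roundStart enc ε X)) ∧
      (q ∉ N.accept → ((N.sweepMachine enc ε).AcceptsFrom (N.roundStart enc ε X) ↔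
        (N.sweepMachine enc ε).AcceptsFrom (N.roundStart enc ε Y))) := by
  have hacc := N.step_eq_none_of_accept enc ε
  have hback := N.steps_back enc ε X []
  rw [List.append_nil] at hback
  by_cases h : ∃ p ∈ N.start, p ∈ N.good X
  · right
    obtain ⟨hstart, hgood⟩ := h.choose_spec
    obtain ⟨Y, q, hrun, hq, hfwd⟩ := N.steps_fwd enc ε X [] hgood
    have hsteps := (hback.trans
      (DTM.Steps.single (DTM.step_atLeft_nil _ (by exact dif_pos h) _))).trans hfwd
    refine ⟨_, hstart, Y, q, hq, hrun, fun hqa => ?_, fun hqa => ?_⟩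
    · exact ⟨_, hsteps.trans (DTM.Steps.single
        (DTM.step_atRight_nil _ (by exact if_pos hqa) _)), rfl⟩
    · exact (hsteps.trans (DTM.Steps.single
        (DTM.step_atRight_nil _ (by exact if_neg hqa) _))).acceptsFrom_iff hacc
  · left
    constructor
    · rintro ⟨p, hp, Y, q, hq, hrun⟩
      exact h ⟨p, hp, hrun.mem_good hq⟩
    · refine fun hX => DTM.not_acceptsFrom_of_step_eq_none (DTM.step_eq_none _ ?_)
        (fun e => ?_) ((hback.acceptsFrom_iff hacc).1 hX)
      · exact dif_neg h
      · cases e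

/-- The word over `B` that replaces the input. -/
def encode : Bool → List A → List B
  | b, [] => [enc b none]
  | b, a :: w => enc b (some a) :: encode false w

theorem steps_init {b : Bool} (w : List A) (hw : b = true → w = [] → ε) (X : List B) :
    (N.sweepMachine enc ε).Steps
      ((N.sweepMachine enc ε).atRight (.init b) (X.map .cell) (w.map .input))
      (N.roundStart enc ε (X ++ encode enc b w)) := by
  induction w generalizing b X with
  | nil =>
    have h := DTM.step_atRight_extend (N.sweepMachine enc ε) (q := .init b) (q' := .turn)
      (y := .cell (enc b none)) (by exact if_pos fun hb => hw hb rfl) (X.map .cell)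
    rw [roundStart, encode, List.map_append]
    exact (DTM.Steps.single h).trans (DTM.Steps.single (DTM.step_atRight_nil _ rfl _))
  | cons a w ih =>
    have := ih (b := false) (by simp) (X ++ [enc b (some a)])
    rw [List.append_assoc, List.map_append] at this
    exact (DTM.Steps.single (DTM.step_atRight_cons _ rfl _ _)).trans this

theorem mem_acceptedLanguage_sweepMachine (w : List A) :
    w ∈ (N.sweepMachine enc ε).acceptedLanguage ↔
      (w = [] → ε) ∧
        (N.sweepMachine enc ε).AcceptsFrom (N.roundStart enc ε (encode enc true w)) := by
  have hacc := N.step_eq_none_of_accept enc ε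
  change (N.sweepMachine enc ε).AcceptsFrom ((N.sweepMachine enc ε).init w) ↔ _
  rw [DTM.init_eq]
  by_cases hw : w = [] → ε
  · rw [and_iff_right hw]
    exact (N.steps_init enc ε (b := true) w (fun _ => hw) []).acceptsFrom_iff hacc
  · simp only [hw, false_and, iff_false]
    push Not at hw
    obtain ⟨rfl, hε⟩ := hw
    refine DTM.not_acceptsFrom_of_step_eq_none (DTM.step_eq_none _ ?_) (fun e => by cases e)
    exact if_neg (by simpa using hε)

end LetterTransducer

/-! ### Synchronized transducers on words cut into blocks -/

namespace Transducer

variable {Γ Q : Type} {T : Transducer Γ Q}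

/-- `T.Reads q u v q'`: some run from `q` to `q'` has input `u` and output `v`. -/
def Reads (T : Transducer Γ Q) (q : Q) (u v : List Γ) (q' : Q) : Prop :=
  ∃ l, T.Run q l q' ∧ (l.map Prod.fst).reduceOption = u ∧ (l.map Prod.snd).reduceOption = v

theorem Run.append {q r q' : Q} {l l' : List (Option Γ × Option Γ)} (h : T.Run q l r)
    (h' : T.Run r l' q') : T.Run q (l ++ l') q' := by
  induction h with
  | nil => exact h'
  | cons h _ ih => exact .cons h (ih h')

theorem Run.of_append {q q' : Q} {l l' : List (Option Γ × Option Γ)}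
    (h : T.Run q (l ++ l') q') : ∃ r, T.Run q l r ∧ T.Run r l' q' := by
  induction l generalizing q with
  | nil => exact ⟨q, .nil q, h⟩
  | cons x l ih =>
    cases h with
    | cons hx h =>
      obtain ⟨r, h₁, h₂⟩ := ih h
      exact ⟨r, .cons hx h₁, h₂⟩

theorem Reads.refl (q : Q) : T.Reads q [] [] q := ⟨[], .nil q, rfl, rfl⟩

theorem Reads.append {q r q' : Q} {u v u' v' : List Γ} (h : T.Reads q u v r)
    (h' : T.Reads r u' v' q') : T.Reads q (u ++ u') (v ++ v') q' := by
  obtain ⟨l, hl, rfl, rfl⟩ := h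
  obtain ⟨l', hl', rfl, rfl⟩ := h'
  exact ⟨l ++ l', hl.append hl', by simp [List.reduceOption_append],
    by simp [List.reduceOption_append]⟩

theorem rel_iff_reads {u v : List Γ} :
    T.Rel u v ↔ ∃ q ∈ T.final, T.Reads T.start u v q := by
  constructor
  · rintro ⟨l, q, hq, h⟩
    exact ⟨q, hq, l, h⟩
  · rintro ⟨q, hq, l, h⟩
    exact ⟨l, q, hq, h⟩

/-- Two states linked by a run of empty input are linked by one of bounded length. -/
theorem exists_bound_of_input_nil [Finite Q] (T : Transducer Γ Q) :
    ∃ c : ℕ, ∀ q q' l, T.Run q l q' → (l.map Prod.fst).reduceOption = [] →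
      ∃ l', T.Run q l' q' ∧ (l'.map Prod.fst).reduceOption = [] ∧ l'.length ≤ c := by
  have h : ∀ z : Q × Q, ∃ n : ℕ, ∀ l, T.Run z.1 l z.2 → (l.map Prod.fst).reduceOption = [] →
      ∃ l', T.Run z.1 l' z.2 ∧ (l'.map Prod.fst).reduceOption = [] ∧ l'.length ≤ n := by
    intro z
    by_cases hz : ∃ l, T.Run z.1 l z.2 ∧ (l.map Prod.fst).reduceOption = []
    · obtain ⟨l, h₁, h₂⟩ := hz
      exact ⟨l.length, fun _ _ _ => ⟨l, h₁, h₂, le_rfl⟩⟩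
    · exact ⟨0, fun l h₁ h₂ => absurd ⟨l, h₁, h₂⟩ hz⟩
  choose f hf using h
  obtain ⟨c, hc⟩ := Finite.exists_le f
  refine ⟨c, fun q q' l h₁ h₂ => ?_⟩
  obtain ⟨l', h₃, h₄, h₅⟩ := hf (q, q') l h₁ h₂
  exact ⟨l', h₃, h₄, h₅.trans (hc _)⟩

/-- If the input `u` has an image under a synchronized transducer, it has one given by a run
that first reads `u`, writing only while it reads, and then writes a word of bounded length. -/
theorem IsSynchronized.exists_run (hT : T.IsSynchronized) {c : ℕ}
    (hc : ∀ q q' l, T.Run q l q' → (l.map Prod.fst).reduceOption = [] →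
      ∃ l', T.Run q l' q' ∧ (l'.map Prod.fst).reduceOption = [] ∧ l'.length ≤ c)
    {u v : List Γ} (h : T.Rel u v) :
    ∃ l₁ l₂ q, ∃ q' ∈ T.final, T.Run T.start l₁ q ∧ T.Run q l₂ q' ∧
      (∀ x ∈ l₁, x.1 = none → x.2 = none) ∧ (l₁.map Prod.fst).reduceOption = u ∧
      (l₂.map Prod.fst).reduceOption = [] ∧ l₂.length ≤ c := by
  obtain ⟨l, q', hq', hl, hu, -⟩ := h
  obtain ⟨l₁, l₂, rfl, h₁, h₂⟩ := hT l q' hl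
  rcases h₂ with h₂ | h₂
  · obtain ⟨r, hr₁, hr₂⟩ := hl.of_append
    have hnil : (l₂.map Prod.fst).reduceOption = [] := by
      simpa [List.reduceOption] using h₂
    obtain ⟨l', h₃, h₄, h₅⟩ := hc _ _ _ hr₂ hnil
    -- The short tail `l'` need not write what `l₂` wrote, which is why the conclusion does not
    -- mention `v`.
    refine ⟨l₁, l', r, q', hq', hr₁, h₃, fun x hx hx' => absurd hx' (h₁ x hx).1, ?_, h₄, h₅⟩
    rwa [List.map_append, List.reduceOption_append, hnil, List.append_nil] at hu
  -- A tail without output never writes without reading, so the whole run serves as first part.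
  · refine ⟨l₁ ++ l₂, [], q', q', hq', hl, .nil _, ?_, hu, rfl, Nat.zero_le _⟩
    intro x hx hx'
    rcases List.mem_append.1 hx with hx | hx
    · exact absurd hx' (h₁ x hx).1
    · exact h₂ x hx

theorem length_output_le {l : List (Option Γ × Option Γ)}
    (h : ∀ x ∈ l, x.1 = none → x.2 = none) :
    (l.map Prod.snd).reduceOption.length ≤ (l.map Prod.fst).reduceOption.length := by
  induction l with
  | nil => rfl
  | cons x l ih =>
    have ih := ih fun y hy => h y (List.mem_cons_of_mem _ hy)
    have hx := h x List.mem_cons_self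
    obtain ⟨_ | a, _ | b⟩ := x
    · simpa using ih
    · simp at hx
    · simpa using ih.trans (Nat.le_succ _)
    · simpa using ih

end Transducer

namespace LetterTransducer

variable {B P : Type} {N : LetterTransducer B P}

theorem Run.append {p r q : P} {X Y X' Y' : List B} (h : N.Run p X Y r)
    (h' : N.Run r X' Y' q) : N.Run p (X ++ X') (Y ++ Y') q := by
  induction h with
  | nil => exact h'
  | cons h _ ih => exact .cons h (ih h')

theorem Run.of_append {p q : P} {X X' Y : List B} (h : N.Run p (X ++ X') Y q) :
    ∃ Y₁ Y₂ r, Y = Y₁ ++ Y₂ ∧ N.Run p X Y₁ r ∧ N.Run r X' Y₂ q := by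
  induction X generalizing p Y with
  | nil => exact ⟨[], Y, p, rfl, .nil p, h⟩
  | cons x X ih =>
    cases h with
    | cons hx h =>
      obtain ⟨Y₁, Y₂, r, rfl, h₁, h₂⟩ := ih h
      exact ⟨_ :: Y₁, Y₂, r, rfl, .cons hx h₁, h₂⟩

end LetterTransducer

/-- A piece of the tape: an input letter not yet used, if any, and a word of length at most
`K`. -/
abbrev Block (A Γ : Type) (K : ℕ) : Type := Option A × {l : List Γ // l.length ≤ K}

instance {Γ : Type} [Finite Γ] (K : ℕ) : Finite {l : List Γ // l.length ≤ K} :=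
  (List.finite_length_le Γ K).to_subtype

/-- The word cut into the given blocks. -/
def blockWord {A Γ : Type} {K : ℕ} (X : List (Block A Γ K)) : List Γ :=
  X.flatMap fun x => x.2.1

/-! ### Following one edge of the graph on a word cut into blocks -/

section Blocks

variable {A Γ σ : Type} {Q : A → Type} {K : ℕ}

/-- The states of `blockTransducer`. -/
inductive BlockState (Q : A → Type) (σ : Type) : Type
  | work (a : A) (q : Q a) (used : Bool)
  | eval (s : σ)

instance [Finite A] [∀ a, Finite (Q a)] [Finite σ] : Finite (BlockState Q σ) :=
  Finite.of_injective
    (fun s : BlockState Q σ => match s with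
      | .work a q b => (Sum.inl ⟨a, q, b⟩ : (Σ a, Q a × Bool) ⊕ σ)
      | .eval s => Sum.inr s)
    (by
      rintro (⟨a, q, b⟩ | s) (⟨a', q', b'⟩ | s') h <;> cases h <;> rfl)

/-- The transitions of `blockTransducer`. -/
inductive BlockStep (T : ∀ a, Transducer Γ (Q a)) (D : DFA Γ σ) :
    BlockState Q σ → Block A Γ K → Block A Γ K → BlockState Q σ → Prop
  | read {a : A} {q q' : Q a} {x y : {l : List Γ // l.length ≤ K}} :
      (T a).Reads q x.1 y.1 q' →
      BlockStep T D (.work a q false) (none, x) (none, y) (.work a q' false)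
  | use {a : A} {q q' : Q a} {x y : {l : List Γ // l.length ≤ K}} :
      (T a).Reads q x.1 y.1 q' →
      BlockStep T D (.work a q false) (some a, x) (none, y) (.work a q' true)
  | idle {a : A} {q : Q a} (x : Block A Γ K) : x.2.1 = [] →
      BlockStep T D (.work a q true) x x (.work a q true)
  | eval (s : σ) (x : {l : List Γ // l.length ≤ K}) :
      BlockStep T D (.eval s) (none, x) (none, x) (.eval (D.evalFrom s x.1))

/-- The transducer on blocks that uses the first remaining input letter `a` and applies `T a` to
the word cut into blocks, or, when no input letter remains, accepts if this word is accepted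
by `D`. -/
def blockTransducer (T : ∀ a, Transducer Γ (Q a)) (D : DFA Γ σ) (K : ℕ) :
    LetterTransducer (Block A Γ K) (BlockState Q σ) where
  step := BlockStep T D
  start := {p | (∃ a, p = .work a (T a).start false) ∨ p = .eval D.start}
  final := {p | (∃ a, ∃ q ∈ (T a).final, p = .work a q true) ∨ ∃ s ∈ D.accept, p = .eval s}
  accept := Set.range .eval

/-- The initial content of a cell: the first cell contains the initial vertex. -/
def blockEnc (A : Type) {Γ : Type} {K : ℕ} (i : {l : List Γ // l.length ≤ K}) (first : Bool)
    (a : Option A) : Block A Γ K :=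
  (a, if first then i else ⟨[], Nat.zero_le K⟩)

variable {T : ∀ a, Transducer Γ (Q a)} {D : DFA Γ σ}

/-- The run is cut where the input of each block has been consumed. Each piece writes no more than
it reads, so its output fits in the block; the unread part `b` is left for the cell of the current
letter. -/
theorem run_work_of_run {a : A} {q q' : Q a} {l : List (Option Γ × Option Γ)}
    (hl : (T a).Run q l q') (hx : ∀ x ∈ l, x.1 = none → x.2 = none)
    {X : List (Block A Γ K)} (hX : ∀ x ∈ X, x.1 = none) {b : List Γ}
    (hb : (l.map Prod.fst).reduceOption = blockWord X ++ b) :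
    ∃ Y r s, (blockTransducer T D K).Run (.work a q false) X Y (.work a r false) ∧
      (T a).Run r s q' ∧ (∀ x ∈ s, x.1 = none → x.2 = none) ∧
      (s.map Prod.fst).reduceOption = b := by
  induction X generalizing q l with
  | nil => exact ⟨[], q, l, .nil _, hl, hx, hb⟩
  | cons x X ih =>
    obtain ⟨o, x⟩ := x
    obtain rfl : o = none := hX _ List.mem_cons_self
    have hb' : l.filterMap Prod.fst = x.1 ++ (blockWord X ++ b) := by
      rw [← List.append_assoc]
      simpa [List.reduceOption, List.filterMap_map, blockWord] using hb
    obtain ⟨l₁, l₂, rfl, h₁, h₂⟩ := List.filterMap_eq_append_iff.1 hb'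
    have h₁ : (l₁.map Prod.fst).reduceOption = x.1 := by
      simpa [List.reduceOption, List.filterMap_map] using h₁
    have h₂ : (l₂.map Prod.fst).reduceOption = blockWord X ++ b := by
      simpa [List.reduceOption, List.filterMap_map] using h₂
    obtain ⟨t, ht₁, ht₂⟩ := hl.of_append
    obtain ⟨Y, r, s, hY, hs⟩ := ih ht₂ (fun x hx' => hx x (List.mem_append_right _ hx'))
      (fun x hx' => hX x (List.mem_cons_of_mem _ hx')) h₂
    have hlen := Transducer.length_output_le fun x hx' => hx x (List.mem_append_left _ hx')
    rw [h₁] at hlen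
    exact ⟨(none, ⟨_, hlen.trans x.2⟩) :: Y, r, s, .cons (.read ⟨l₁, ht₁, h₁, rfl⟩) hY, hs⟩

theorem run_idle {a : A} {q : Q a} {X : List (Block A Γ K)} (hX : ∀ x ∈ X, x.2.1 = []) :
    (blockTransducer T D K).Run (.work a q true) X X (.work a q true) := by
  induction X with
  | nil => exact .nil _
  | cons x X ih =>
    exact .cons (.idle x (hX x List.mem_cons_self)) (ih fun y hy => hX y (List.mem_cons_of_mem _ hy))

theorem run_eval {s : σ} {X : List (Block A Γ K)} (hX : ∀ x ∈ X, x.1 = none) :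
    (blockTransducer T D K).Run (.eval s) X X (.eval (D.evalFrom s (blockWord X))) := by
  induction X generalizing s with
  | nil => exact .nil _
  | cons x X ih =>
    obtain ⟨o, x⟩ := x
    obtain rfl : o = none := hX _ List.mem_cons_self
    have := ih (s := D.evalFrom s x.1) fun y hy => hX y (List.mem_cons_of_mem _ hy)
    rw [← DFA.evalFrom_of_append] at this
    exact .cons (.eval s x) this

/-- Blocks without a letter offer no `use` step, so the state cannot become `used`; in particular
such a run is never final. -/
theorem reads_of_run_work {a : A} {q : Q a} {p : BlockState Q σ} {X Y : List (Block A Γ K)}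
    (hX : ∀ x ∈ X, x.1 = none) (h : (blockTransducer T D K).Run (.work a q false) X Y p) :
    ∃ q', p = .work a q' false ∧ (∀ y ∈ Y, y.1 = none) ∧
      (T a).Reads q (blockWord X) (blockWord Y) q' := by
  induction X generalizing q Y with
  | nil =>
    cases h
    exact ⟨q, rfl, by simp, .refl q⟩
  | cons x X ih =>
    have hx := hX _ List.mem_cons_self
    cases h with
    | cons hstep h =>
      cases hstep with
      | read hr =>
        obtain ⟨q', rfl, hY, hq'⟩ := ih (fun y hy => hX y (List.mem_cons_of_mem _ hy)) h
        exact ⟨q', rfl, by simpa using hY, hr.append hq'⟩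
      | use => cases hx

theorem eq_of_run_idle {a : A} {q : Q a} {p : BlockState Q σ} {X Y : List (Block A Γ K)}
    (h : (blockTransducer T D K).Run (.work a q true) X Y p) :
    Y = X ∧ p = .work a q true := by
  induction X generalizing Y with
  | nil => cases h; exact ⟨rfl, rfl⟩
  | cons x X ih =>
    cases h with
    | cons hstep h =>
      cases hstep with
      | idle _ _ =>
        obtain ⟨rfl, rfl⟩ := ih h
        exact ⟨rfl, rfl⟩

theorem eq_of_run_eval {s : σ} {p : BlockState Q σ} {X Y : List (Block A Γ K)}
    (h : (blockTransducer T D K).Run (.eval s) X Y p) :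
    (∀ x ∈ X, x.1 = none) ∧ p = .eval (D.evalFrom s (blockWord X)) := by
  induction X generalizing s Y with
  | nil => cases h; exact ⟨by simp, rfl⟩
  | cons x X ih =>
    cases h with
    | cons hstep h =>
      cases hstep with
      | eval _ x =>
        obtain ⟨hX, rfl⟩ := ih h
        refine ⟨by simpa using hX, ?_⟩
        rw [← DFA.evalFrom_of_append]
        rfl

theorem encode_false_word_nil (i : {l : List Γ // l.length ≤ K}) (u : List A) :
    ∀ x ∈ LetterTransducer.encode (blockEnc A i) false u, x.2.1 = [] := by
  induction u with
  | nil => simp [LetterTransducer.encode, blockEnc]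
  | cons a u ih => simpa [LetterTransducer.encode, blockEnc] using ih

/-- The tape content `X` followed by the encoding of `u` represents the vertex `v`, which is cut
into blocks, and the remaining input `u`. The machine accepts if there is a path labelled by `u`
from `v` to a final vertex. -/
theorem acceptsFrom_roundStart_iff (hT : ∀ a, (T a).IsSynchronized)
    (hdet : (rationalGraph T).IsDeterministic) {c : ℕ}
    (hc : ∀ a q q' l, (T a).Run q l q' → (l.map Prod.fst).reduceOption = [] →
      ∃ l', (T a).Run q l' q' ∧ (l'.map Prod.fst).reduceOption = [] ∧ l'.length ≤ c)
    (i : {l : List Γ // l.length ≤ K}) (hi : i.1.length + c ≤ K) (ε : Prop) (u : List A)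
    (first : Bool) (X : List (Block A Γ K)) (hX : ∀ x ∈ X, x.1 = none) :
    ((blockTransducer T D K).sweepMachine (blockEnc A i) ε).AcceptsFrom
        ((blockTransducer T D K).roundStart (blockEnc A i) ε
          (X ++ LetterTransducer.encode (blockEnc A i) first u)) ↔
      ∃ t ∈ D.accepts, (rationalGraph T).Path
        (blockWord X ++ (blockEnc A i first none).2.1) u t := by
  -- `first` is `true` only before the first edge; afterwards all cells with unused letters hold the
  -- empty word.
  induction u generalizing first X with
  | nil =>
    set Z : List (Block A Γ K) := X ++ LetterTransducer.encode (blockEnc A i) first [] with hZdef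
    have hZ : ∀ x ∈ Z, x.1 = none := by
      intro x hx
      rcases List.mem_append.1 hx with hx | hx
      · exact hX x hx
      · rw [List.mem_singleton.1 hx]; rfl
    have hw : blockWord Z = blockWord X ++ (blockEnc A i first none).2.1 := by
      simp [hZdef, blockWord, LetterTransducer.encode]
    have hpath : (∃ t ∈ D.accepts, (rationalGraph T).Path (blockWord Z) [] t) ↔
        D.evalFrom D.start (blockWord Z) ∈ D.accept := by
      constructor
      · rintro ⟨t, ht, h⟩
        cases h
        exact ht
      · exact fun h => ⟨_, h, .nil _⟩
    rw [← hw, hpath]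
    rcases (blockTransducer T D K).round (blockEnc A i) ε Z with ⟨h, hacc⟩ |
      ⟨p, hp, Y, q, hq, hrun, hacc, -⟩
    -- If the word were in `D.accepts`, evaluating `D` would be a successful run.
    · exact iff_of_false hacc fun hD =>
        h ⟨_, Or.inr rfl, Z, _, Or.inr ⟨_, hD, rfl⟩, run_eval hZ⟩
    · rcases hp with ⟨a, rfl⟩ | rfl
      · obtain ⟨q', rfl, -, -⟩ := reads_of_run_work hZ hrun
        rcases hq with ⟨b, r, -, h⟩ | ⟨s, -, h⟩ <;> cases h
      · obtain ⟨-, rfl⟩ := eq_of_run_eval hrun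
        refine iff_of_true (hacc ⟨_, rfl⟩) ?_
        rcases hq with ⟨b, r, -, h⟩ | ⟨s, hs, h⟩
        · cases h
        · cases h; exact hs
  | cons a u ih =>
    set b : {l : List Γ // l.length ≤ K} := (blockEnc A i first none).2 with hb
    have hlen : b.1.length ≤ i.1.length := by
      cases first <;> simp [hb, blockEnc]
    have henc : LetterTransducer.encode (blockEnc A i) first (a :: u) =
        (some a, b) :: LetterTransducer.encode (blockEnc A i) false u := rfl
    rw [henc]
    rcases (blockTransducer T D K).round (blockEnc A i) ε
      (X ++ (some a, b) :: LetterTransducer.encode (blockEnc A i) false u) with ⟨h, hacc⟩ |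
      ⟨p, hp, Y, q, hq, hrun, -, hacc⟩
    · refine iff_of_false hacc ?_
      rintro ⟨t, -, hpath⟩
      cases hpath with
      | cons hedge _ =>
        obtain ⟨l₁, l₂, q, q', hq', h₁, h₂, hl₁, hin₁, hin₂, hl₂⟩ :=
          (hT a).exists_run (hc a) hedge
        obtain ⟨Y, r, s, hY, hs, hs', hsb⟩ := run_work_of_run (D := D) h₁ hl₁ hX hin₁
        have hlen' := Transducer.length_output_le hs'
        have hlen₂ := List.reduceOption_length_le (l₂.map Prod.snd)
        rw [List.length_map] at hlen₂
        rw [hsb] at hlen'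
        have hread := Transducer.Reads.append (T := T a) ⟨s, hs, hsb, rfl⟩ ⟨l₂, h₂, hin₂, rfl⟩
        rw [List.append_nil] at hread
        -- The cell of `a` receives what is written while reading `b`, at most `|b| ≤ |i|` letters,
        -- and then the tail, at most `c` letters: no more than `K` in all.
        refine h ⟨_, Or.inl ⟨a, rfl⟩, _, _, Or.inl ⟨a, q', hq', rfl⟩,
          hY.append (.cons (.use (y := ⟨_, ?_⟩) hread)
            (run_idle (encode_false_word_nil i u)))⟩
        rw [List.length_append]
        omega
    · obtain ⟨Y₁, Y₂, r, rfl, hr₁, hr₂⟩ := hrun.of_append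
      rcases hp with ⟨a', rfl⟩ | rfl
      · obtain ⟨q₁, rfl, hY₁, hread⟩ := reads_of_run_work hX hr₁
        cases hr₂ with
        | cons hstep hr₂ =>
          cases hstep with
          | @use _ _ q₂ _ y hread' =>
            obtain ⟨rfl, rfl⟩ := eq_of_run_idle hr₂
            have hq₂ : q₂ ∈ (T a).final := by
              rcases hq with ⟨_, _, hq, h⟩ | ⟨_, _, h⟩
              · cases h; exact hq
              · cases h
            have hedge : (rationalGraph T).Edge (blockWord X ++ b.1) a
                (blockWord (Y₁ ++ [(none, y)])) := by
              refine Transducer.rel_iff_reads.2 ⟨q₂, hq₂, ?_⟩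
              simpa [blockWord] using hread.append hread'
            -- The final state is not accepting, so another round begins, with the cell just used
            -- now part of the prefix.
            rw [hacc (by rintro ⟨s, hs⟩; cases hs), List.append_cons,
              ih false (Y₁ ++ [(none, y)]) (by
                intro z hz
                rcases List.mem_append.1 hz with hz | hz
                · exact hY₁ z hz
                · rw [List.mem_singleton.1 hz])]
            have hnil : (blockEnc A i false none).2.1 = [] := rfl
            rw [hnil, List.append_nil]
            constructor
            · rintro ⟨t, ht, hpath⟩
              exact ⟨t, ht, .cons hedge hpath⟩
            · rintro ⟨t, ht, hpath⟩
              cases hpath with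
              | cons hedge' hpath =>
                -- Whichever run the machine followed, its output is the only possible target.
                rw [hdet _ _ _ _ hedge hedge']
                exact ⟨t, ht, hpath⟩
      -- Evaluation of `D` cannot cross the cell that still holds the letter `a`.
      · exfalso
        have := (eq_of_run_eval (hr₁.append hr₂)).1 (some a, b) (by simp)
        cases this

end Blocks

/-- The path language is deterministic context-sensitive, the empty word being kept only if `ε`
holds. -/
theorem isDetContextSensitive_setOf_path {A Γ : Type} [Finite A] [Finite Γ] {Q : A → Type}
    [∀ a, Finite (Q a)] (T : ∀ a, Transducer Γ (Q a)) (hT : ∀ a, (T a).IsSynchronized)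
    (hdet : (rationalGraph T).IsDeterministic) (i : List Γ) (F : Language Γ) (hF : F.IsRegular)
    (ε : Prop) :
    IsDetContextSensitive
      {w : List A | (w = [] → ε) ∧ ∃ t ∈ F, (rationalGraph T).Path i w t} := by
  obtain ⟨σ, _, D, rfl⟩ := hF
  choose f hf using fun a => (T a).exists_bound_of_input_nil
  -- One bound serves all letters, since the alphabet is finite.
  obtain ⟨c, hc⟩ := Finite.exists_le f
  let K := i.length + c
  let i' : {l : List Γ // l.length ≤ K} := ⟨i, Nat.le_add_right _ _⟩
  let N := blockTransducer T D K
  refine ⟨_, _, inferInstance, inferInstance, N.sweepMachine (blockEnc A i') ε,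
    N.isLinearlyBounded_sweepMachine _ _, ?_⟩
  ext w
  rw [N.mem_acceptedLanguage_sweepMachine]
  refine and_congr_right fun _ => ?_
  refine acceptsFrom_roundStart_iff (c := c) hT hdet (fun a q q' l h h' => ?_) i' le_rfl ε w true
    [] (by simp)
  obtain ⟨l', h₁, h₂, h₃⟩ := hf a q q' l h h'
  exact ⟨l', h₁, h₂, h₃.trans (hc a)⟩

end RatGraph

theorem mainTheorem9 {A Γ : Type} [Finite A] [Finite Γ] {Q : A → Type} [∀ a, Finite (Q a)]
    (T : ∀ a, RatGraph.Transducer Γ (Q a)) (hT : ∀ a, (T a).IsSynchronized)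
    (hdet : (RatGraph.rationalGraph T).IsDeterministic)
    (i : List Γ) (F : Language Γ) (hF : F.IsRegular) :
    RatGraph.IsDetContextSensitive ((RatGraph.rationalGraph T).pathLanguage {i} F) ∧
    RatGraph.IsDetContextSensitive ((RatGraph.rationalGraph T).nonemptyPathLanguage {i} F) := by
  -- The two conventions on the empty path are the cases `ε = True` and `ε = False`.
  have h := RatGraph.isDetContextSensitive_setOf_path T hT hdet i F hF
  constructor
  · have e : (RatGraph.rationalGraph T).pathLanguage {i} F =
        {w | (w = [] → True) ∧ ∃ t ∈ F, (RatGraph.rationalGraph T).Path i w t} :=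
      Set.ext fun w => by
        simp [RatGraph.LGraph.pathLanguage]
        exact Iff.rfl
    exact e ▸ h True
  · have e : (RatGraph.rationalGraph T).nonemptyPathLanguage {i} F =
        {w | (w = [] → False) ∧ ∃ t ∈ F, (RatGraph.rationalGraph T).Path i w t} :=
      Set.ext fun w => by
        simp [RatGraph.LGraph.nonemptyPathLanguage]
        exact fun _ => Iff.rfl
    exact e ▸ h False
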